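/- Let $k$ be a commutative ring and let $(H,A,C)$ be a Doi-Hopf datum over $k$ with $H$ a Hopf algebra (no bijectivity of the antipode is assumed): $A$ is a left $H$-comodule algebra, i.e. a $k$-algebra with a coassociative counital coaction $\rho_A:A\to H\otimes A$, $\rho_A(a)=\sum a_{<-1>}\otimes a_{<0>}$, that is an algebra map, and $C$ is a right $H$-module coalgebra, i.e. a $k$-coalgebra with a right $H$-module structure such that $\Delta(c\cdot h)=\sum c_{(1)}\cdot h_{(1)}\otimes c_{(2)}\cdot h_{(2)}$ and $\varepsilon(c\cdot h)=\varepsilon(c)\varepsilon(h)$. Assume that $C$ is finitely generated and projective as a $k$-module. Let $C^*=\mathrm{Hom}_k(C,k)$ be the convolution algebra, with left $H$-action $\langle h\cdot c^*,c\rangle=\langle c^*,c\cdot h\rangle$, and let the smash product $A\#C^*$ be $A\otimes C^*$ as a $k$-module, with multiplication $$(a\#c^*)(b\#d^*)=\sum a_{<0>}b\,\#\,c^**(a_{<-1>}\cdot d^*)$$ and unit $1\#\varepsilon$. Consider the ring extension $A\to A\#C^*$, $a\mapsto a\#\varepsilon$; it is called separable if the multiplication map $(A\#C^*)\otimes_A(A\#C^*)\to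 A\#C^*$ splits as a map of $A\#C^*$-bimodules. Let $i:A\#C^*\to\mathrm{Hom}_k(C,A)$ be the natural map $i(a\#c^*)(c)=\langle c^*,c\rangle a$. Let $A$ act on $\mathrm{Hom}_k(C,A)$ by $(a\cdot f)(c)=\sum a_{<0>}f(c\cdot a_{<-1>})$ and $(f\cdot a)(c)=f(c)a$. A $k$-linear map $\gamma:C\to\mathrm{Hom}_k(C,A)$ is called an $A$-integral if for all $a\in A$ and $c,d\in C$ $$\sum a_{<0>}\cdot\gamma(c\cdot a_{<-1>})=\gamma(c)\cdot a,\qquad \sum c_{(1)}\otimes\gamma(c_{(2)})(d)=\sum d_{(2)}\cdot\gamma(c)(d_{(1)})_{<-1>}\otimes\gamma(c)(d_{(1)})_{<0>},$$ and it is normalized if $\sum\gamma(c_{(1)})(c_{(2)})=\varepsilon(c)1_A$ for all $c\in C$. A $k$-linear map $\gamma:C\to A\#C^*$ is called a (normalized) $A$-integral if $i\circ\gamma$ is one. Then the following statements are equivalent: 1) the extension $A\to A\#C^*$ is separable; 2) there exists a normalized $A$-integral $\gamma:C\to A\#C^*$. If these hold and $A$ is semisimple artinian, then $A\#C^*$ is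 semisimple artinian too. -/

import Mathlib

open scoped TensorProduct

noncomputable section

/-! ### Separable ring extensions -/

namespace SeparableExtension

variable {k A S : Type*} [CommRing k] [Ring A] [Algebra k A] [Ring S] [Algebra k S]

/-- The submodule of `S ⊗[k] S` generated by all `s f(a) ⊗ t - s ⊗ f(a) t`. -/
def balanced (f : A →ₐ[k] S) : Submodule k (S ⊗[k] S) :=
  Submodule.span k {x | ∃ (s t : S) (a : A), x = (s * f a) ⊗ₜ[k] t - s ⊗ₜ[k] (f a * t)}

/-- The tensor product `S ⊗_A S` over the (possibly noncommutative) `k`-algebra `A`, where `S` is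
an `A`-bimodule through `f : A → S`. -/
abbrev RelTensor (f : A →ₐ[k] S) : Type _ := (S ⊗[k] S) ⧸ balanced f

/-- The left action of `s : S` on `S ⊗_A S`, `s (t ⊗ u) = s t ⊗ u`. -/
def leftMul (f : A →ₐ[k] S) (s : S) : RelTensor f →ₗ[k] RelTensor f :=
  (balanced f).mapQ (balanced f) (LinearMap.rTensor S (LinearMap.mulLeft k s)) (by
    rw [balanced, Submodule.span_le]
    rintro _ ⟨t, u, a, rfl⟩
    refine Submodule.subset_span ⟨s * t, u, a, ?_⟩
    simp [mul_assoc])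

/-- The right action of `s : S` on `S ⊗_A S`, `(t ⊗ u) s = t ⊗ u s`. -/
def rightMul (f : A →ₐ[k] S) (s : S) : RelTensor f →ₗ[k] RelTensor f :=
  (balanced f).mapQ (balanced f) (LinearMap.lTensor S (LinearMap.mulRight k s)) (by
    rw [balanced, Submodule.span_le]
    rintro _ ⟨t, u, a, rfl⟩
    refine Submodule.subset_span ⟨t, u * s, a, ?_⟩
    simp [mul_assoc])

/-- The multiplication map `S ⊗_A S → S`. -/
def mulMap (f : A →ₐ[k] S) : RelTensor f →ₗ[k] S :=
  (balanced f).liftQ (LinearMap.mul' k S) (by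
    rw [balanced, Submodule.span_le]
    rintro _ ⟨t, u, a, rfl⟩
    simp [mul_assoc])

end SeparableExtension

open SeparableExtension in
/-- The extension `f : A → S` is separable if the multiplication map `S ⊗_A S → S` splits as a map
of `S`-bimodules. -/
def IsSeparableExtension {k A S : Type*} [CommRing k] [Ring A] [Algebra k A] [Ring S] [Algebra k S]
    (f : A →ₐ[k] S) : Prop :=
  ∃ σ : S →ₗ[k] RelTensor f,
    (∀ s t : S, σ (s * t) = leftMul f s (σ t)) ∧
    (∀ s t : S, σ (s * t) = rightMul f t (σ s)) ∧
    ∀ s : S, mulMap f (σ s) = s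

/-! ### Doi-Hopf data -/

/-- A Doi-Hopf datum `(H, A, C)` over `k`: the structure of a left `H`-comodule algebra on the
`k`-algebra `A` and the structure of a right `H`-module coalgebra on the `k`-coalgebra `C`. -/
structure DoiHopfDatum (k H A C : Type*) [CommRing k] [Ring H] [Bialgebra k H]
    [Ring A] [Algebra k A] [AddCommGroup C] [Module k C] [Coalgebra k C] where
  /-- The coaction `a ↦ ∑ a_<-1> ⊗ a_<0>`, an algebra map. -/
  coact : A →ₐ[k] H ⊗[k] A
  coact_coassoc : ∀ a : A,
    TensorProduct.assoc k H H A (LinearMap.rTensor A Coalgebra.comul (coact a)) =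
      LinearMap.lTensor H coact.toLinearMap (coact a)
  coact_counit : ∀ a : A,
    TensorProduct.lid k A (LinearMap.rTensor A Coalgebra.counit (coact a)) = a
  /-- The right action `c ↦ h ↦ c · h`. -/
  act : C →ₗ[k] H →ₗ[k] C
  act_one : ∀ c : C, act c 1 = c
  act_mul : ∀ (c : C) (h h' : H), act c (h * h') = act (act c h) h'
  /-- `Δ(c · h) = ∑ c₍₁₎ · h₍₁₎ ⊗ c₍₂₎ · h₍₂₎`. -/
  comul_act : ∀ (c : C) (h : H), Coalgebra.comul (R := k) (act c h) =
    TensorProduct.map₂ act act (Coalgebra.comul (R := k) c) (Coalgebra.comul (R := k) h)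
  /-- `ε(c · h) = ε(c) ε(h)`. -/
  counit_act : ∀ (c : C) (h : H), Coalgebra.counit (R := k) (act c h) =
    Coalgebra.counit (R := k) c * Coalgebra.counit (R := k) h

/-- The dual `C^* = Hom(C, k)` of a `k`-coalgebra, an algebra under the convolution product
`⟨f * g, c⟩ = ∑ ⟨f, c₍₁₎⟩ ⟨g, c₍₂₎⟩`. -/
abbrev ConvDual (k C : Type*) [CommRing k] [AddCommGroup C] [Module k C] : Type _ :=
  WithConv (C →ₗ[k] k)

namespace DoiHopfDatum

section

variable {k H A C : Type*} [CommRing k] [Ring H] [Bialgebra k H]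
  [Ring A] [Algebra k A] [AddCommGroup C] [Module k C] [Coalgebra k C]

/-- The left action of `H` on `C^*`: `⟨h · f, c⟩ = ⟨f, c · h⟩`. -/
def dualAct (D : DoiHopfDatum k H A C) : H →ₐ[k] Module.End k (ConvDual k C) :=
  AlgHom.ofLinearMap
    { toFun := fun h =>
        { toFun := fun f => WithConv.toConv (f.ofConv ∘ₗ D.act.flip h)
          map_add' := fun f g => by ext; simp
          map_smul' := fun r f => by ext; simp }
      map_add' := fun h h' => by ext; simp
      map_smul' := fun r h => by ext; simp }
    (by ext; simp [D.act_one])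
    (fun h h' => by ext; simp [D.act_mul])

@[simp]
theorem dualAct_apply (D : DoiHopfDatum k H A C) (h : H) (f : ConvDual k C) (c : C) :
    D.dualAct h f c = f (D.act c h) := rfl

/-- The smash product `A # C^*`; as a `k`-module it is `A ⊗ C^*`. -/
def Smash (_D : DoiHopfDatum k H A C) : Type _ := A ⊗[k] ConvDual k C

instance (D : DoiHopfDatum k H A C) : AddCommGroup D.Smash :=
  inferInstanceAs (AddCommGroup (A ⊗[k] ConvDual k C))

instance (D : DoiHopfDatum k H A C) : Module k D.Smash :=
  inferInstanceAs (Module k (A ⊗[k] ConvDual k C))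

/-- The element `a # f` of `A # C^*`. -/
def smashMk (D : DoiHopfDatum k H A C) (a : A) (f : ConvDual k C) : D.Smash := a ⊗ₜ[k] f

/-- The operator `b # g ↦ a b # (h · g)` attached to `h ⊗ a`. -/
def twist (D : DoiHopfDatum k H A C) : H ⊗[k] A →ₐ[k] Module.End k (A ⊗[k] ConvDual k C) :=
  Algebra.TensorProduct.lift
    (AlgHom.ofLinearMap
      (LinearMap.lTensorHom (R := k) A (N := ConvDual k C) (P := ConvDual k C) ∘ₗ
        D.dualAct.toLinearMap)
      (by ext; simp) (fun h h' => by ext; simp))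
    (AlgHom.ofLinearMap
      (LinearMap.rTensorHom (R := k) (ConvDual k C) (N := A) (P := A) ∘ₗ LinearMap.mul k A)
      (by ext; simp) (fun a a' => by ext; simp [mul_assoc]))
    (by intro h a; rw [commute_iff_eq]; ext; simp)

@[simp]
theorem twist_tmul (D : DoiHopfDatum k H A C) (h : H) (a b : A) (g : ConvDual k C) :
    D.twist (h ⊗ₜ a) (b ⊗ₜ g) = (a * b) ⊗ₜ[k] D.dualAct h g := by
  rw [twist, Algebra.TensorProduct.lift_tmul]
  change (TensorProduct.map _ _ ∘ₗ TensorProduct.map _ _) (b ⊗ₜ[k] g) = _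
  simp

/-- The operator `b # g ↦ b # f * g`. -/
def convOp (A : Type*) [Ring A] [Algebra k A] :
    ConvDual k C →ₗ[k] Module.End k (A ⊗[k] ConvDual k C) :=
  LinearMap.lTensorHom (R := k) A (N := ConvDual k C) (P := ConvDual k C) ∘ₗ
    LinearMap.mul k (ConvDual k C)

@[simp]
theorem convOp_tmul (f g : ConvDual k C) (b : A) :
    convOp A f (b ⊗ₜ[k] g) = b ⊗ₜ[k] (f * g) := by
  simp [convOp]

theorem convOp_mul (f g : ConvDual k C) :
    convOp A (f * g) = convOp A f * convOp A g := by
  ext; simp [mul_assoc]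

/-- The multiplication of `A # C^*`:
`(a # f) (b # g) = ∑ a_<0> b # f * (a_<-1> · g)`. -/
def smashMul (D : DoiHopfDatum k H A C) :
    A ⊗[k] ConvDual k C →ₗ[k] Module.End k (A ⊗[k] ConvDual k C) :=
  TensorProduct.lift <| LinearMap.mk₂ k (fun a f => convOp A f * D.twist (D.coact a))
    (fun a a' f => by simp [mul_add])
    (fun r a f => by simp)
    (fun a f f' => by simp [add_mul])
    (fun r a f => by simp)

@[simp]
theorem smashMul_tmul (D : DoiHopfDatum k H A C) (a : A) (f : ConvDual k C) :
    D.smashMul (a ⊗ₜ f) = convOp A f * D.twist (D.coact a) := by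
  simp [smashMul]

/-- `h · (f * g) = ∑ (h₍₁₎ · f) * (h₍₂₎ · g)`. -/
theorem dualAct_mul (D : DoiHopfDatum k H A C) (h : H) (f g : ConvDual k C) :
    D.dualAct h (f * g) = LinearMap.mul' k (ConvDual k C)
      (TensorProduct.map (D.dualAct.toLinearMap.flip f) (D.dualAct.toLinearMap.flip g)
        (Coalgebra.comul (R := k) h)) := by
  ext c
  have key : ∀ (x : C ⊗[k] C) (y : H ⊗[k] H),
      LinearMap.mul' k k (TensorProduct.map f.ofConv g.ofConv
        (TensorProduct.map₂ D.act D.act x y)) =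
      TensorProduct.lift (LinearMap.mk₂ k (fun h₁ h₂ => LinearMap.mul' k k
        (TensorProduct.map (D.dualAct h₁ f).ofConv (D.dualAct h₂ g).ofConv x))
        (by simp [TensorProduct.map_add_left]) (by simp [TensorProduct.map_smul_left])
        (by simp [TensorProduct.map_add_right]) (by simp [TensorProduct.map_smul_right])) y := by
    intro x y
    induction y with
    | zero => simp
    | add y z hy hz => simp only [map_add, hy, hz]
    | tmul h₁ h₂ =>
      induction x with
      | zero => simp
      | add x z hx hz =>
        simp only [map_add, LinearMap.add_apply, hx, hz, TensorProduct.lift.tmul,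
          LinearMap.mk₂_apply]
      | tmul c₁ c₂ => simp
  have hl : (D.dualAct h (f * g)) c = LinearMap.mul' k k (TensorProduct.map f.ofConv g.ofConv
      (Coalgebra.comul (R := k) (D.act c h))) := rfl
  refine hl.trans ?_
  rw [D.comul_act, key]
  generalize Coalgebra.comul (R := k) h = y
  induction y with
  | zero => simp
  | add y z hy hz => simp only [map_add, hy, hz, WithConv.ofConv_add, LinearMap.add_apply]
  | tmul h₁ h₂ => simp

/-- `h ⊗ y ↦ (1 # (h · g)) y`, as an operator on `A # C^*`. -/
def mixOp (D : DoiHopfDatum k H A C) (g : ConvDual k C) :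
    H ⊗[k] (H ⊗[k] A) →ₗ[k] Module.End k (A ⊗[k] ConvDual k C) :=
  TensorProduct.lift <| LinearMap.mk₂ k
    (fun h y => convOp A (D.dualAct h g) * D.twist y)
    (by simp [add_mul]) (by simp) (by simp [mul_add]) (by simp)

@[simp]
theorem mixOp_tmul (D : DoiHopfDatum k H A C) (g : ConvDual k C) (h : H) (y : H ⊗[k] A) :
    D.mixOp g (h ⊗ₜ y) = convOp A (D.dualAct h g) * D.twist y := by
  simp [mixOp]

theorem twist_mul_convOp (D : DoiHopfDatum k H A C) (g : ConvDual k C) (z : H ⊗[k] A) :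
    D.twist z * convOp A g = D.mixOp g
      (TensorProduct.assoc k H H A (LinearMap.rTensor A Coalgebra.comul z)) := by
  induction z with
  | zero => simp
  | add y z hy hz => simp only [map_add, add_mul, hy, hz]
  | tmul h a =>
    ext b e
    simp only [TensorProduct.AlgebraTensorModule.curry_apply, TensorProduct.curry_apply,
      LinearMap.coe_restrictScalars, Module.End.mul_apply, convOp_tmul, twist_tmul,
      LinearMap.rTensor_tmul, D.dualAct_mul]
    generalize Coalgebra.comul (R := k) h = y
    induction y with
    | zero => simp
    | add y z hy hz =>
      simp only [map_add, TensorProduct.tmul_add, TensorProduct.add_tmul, hy, hz,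
        LinearMap.add_apply]
    | tmul h₁ h₂ => simp

theorem smashMul_aux (D : DoiHopfDatum k H A C) (f g : ConvDual k C) (b : A) (z : H ⊗[k] A) :
    D.smashMul (convOp A f (D.twist z (b ⊗ₜ g))) =
      convOp A f * D.mixOp g (LinearMap.lTensor H D.coact.toLinearMap z) *
        D.twist (D.coact b) := by
  induction z with
  | zero => simp
  | add y z hy hz => simp only [map_add, LinearMap.add_apply, mul_add, add_mul, hy, hz]
  | tmul h a => simp [convOp_mul, mul_assoc]

theorem smashMul_assoc (D : DoiHopfDatum k H A C) (x y : A ⊗[k] ConvDual k C) :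
    D.smashMul (D.smashMul x y) = D.smashMul x * D.smashMul y := by
  induction x with
  | zero => simp
  | add x z hx hz => simp only [map_add, LinearMap.add_apply, add_mul, hx, hz]
  | tmul a f =>
    induction y with
    | zero => simp
    | add x z hx hz => simp only [map_add, mul_add, hx, hz]
    | tmul b g =>
      rw [smashMul_tmul, Module.End.mul_apply, smashMul_aux, ← D.coact_coassoc,
        ← twist_mul_convOp, smashMul_tmul]
      simp only [mul_assoc]

theorem dualAct_one (D : DoiHopfDatum k H A C) (h : H) :
    D.dualAct h (1 : ConvDual k C) = Coalgebra.counit (R := k) h • 1 := by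
  ext c
  exact (D.counit_act c h).trans (mul_comm _ _)

theorem twist_coact_one (D : DoiHopfDatum k H A C) (a b : A) :
    D.twist (D.coact a) (b ⊗ₜ 1) = (a * b) ⊗ₜ 1 := by
  have key : ∀ z : H ⊗[k] A, D.twist z (b ⊗ₜ 1) =
      (TensorProduct.lid k A (LinearMap.rTensor A Coalgebra.counit z) * b) ⊗ₜ 1 := by
    intro z
    induction z with
    | zero => simp
    | add x z hx hz =>
      simp only [map_add, LinearMap.add_apply, hx, hz, TensorProduct.add_tmul, add_mul]
    | tmul h a => simp [dualAct_one, TensorProduct.smul_tmul']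
  rw [key, D.coact_counit]

theorem smashMul_one (D : DoiHopfDatum k H A C) (x : A ⊗[k] ConvDual k C) :
    D.smashMul x (1 ⊗ₜ 1) = x := by
  induction x with
  | zero => simp
  | add x z hx hz => simp only [map_add, LinearMap.add_apply, hx, hz]
  | tmul a f => simp [twist_coact_one]

theorem one_smashMul (D : DoiHopfDatum k H A C) (x : A ⊗[k] ConvDual k C) :
    D.smashMul (1 ⊗ₜ 1) x = x := by
  have h : convOp A (1 : ConvDual k C) = 1 := by ext; simp
  simp [h]

instance (D : DoiHopfDatum k H A C) : Ring D.Smash :=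
  { (inferInstance : AddCommGroup D.Smash) with
    mul := fun x y => D.smashMul x y
    one := D.smashMk 1 1
    left_distrib := fun x y z => map_add (D.smashMul x) y z
    right_distrib := fun x y z => LinearMap.congr_fun (map_add D.smashMul x y) z
    zero_mul := fun x => LinearMap.congr_fun (map_zero D.smashMul) x
    mul_zero := fun x => map_zero (D.smashMul x)
    mul_assoc := fun x y z => LinearMap.congr_fun (D.smashMul_assoc x y) z
    one_mul := D.one_smashMul
    mul_one := D.smashMul_one }

instance (D : DoiHopfDatum k H A C) : Algebra k D.Smash :=
  Algebra.ofModule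
    (fun r x y => LinearMap.congr_fun (map_smul D.smashMul r x) y)
    (fun r x y => map_smul (D.smashMul x) r y)

/-- If `ρ(a) = ∑ hᵢ ⊗ aᵢ`, then `(a # f) (b # g) = ∑ aᵢ b # f * (hᵢ · g)`. -/
theorem smashMk_mul_smashMk (D : DoiHopfDatum k H A C) {ι : Type*} (s : Finset ι) (h : ι → H) (a' : ι → A)
    (a b : A) (f g : ConvDual k C) (ha : D.coact a = ∑ i ∈ s, h i ⊗ₜ[k] a' i) :
    D.smashMk a f * D.smashMk b g = ∑ i ∈ s, D.smashMk (a' i * b) (f * D.dualAct (h i) g) := by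
  change D.smashMul (a ⊗ₜ f) (b ⊗ₜ g) = ∑ i ∈ s, (a' i * b) ⊗ₜ[k] (f * D.dualAct (h i) g)
  simp [ha]

/-- The algebra map `A → A # C^*`, `a ↦ a # ε`. -/
def incl (D : DoiHopfDatum k H A C) : A →ₐ[k] D.Smash :=
  AlgHom.ofLinearMap
    { toFun := fun a => D.smashMk a 1
      map_add' := fun a b => TensorProduct.add_tmul a b 1
      map_smul' := fun _ _ => rfl }
    rfl
    (fun a b => by
      change (a * b) ⊗ₜ[k] (1 : ConvDual k C) = D.smashMul (a ⊗ₜ 1) (b ⊗ₜ 1)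
      simp [twist_coact_one])

/-- The natural map `i : A # C^* → Hom(C, A)`, `i(a # f)(c) = ⟨f, c⟩ a`. -/
def toHom (D : DoiHopfDatum k H A C) : D.Smash →ₗ[k] C →ₗ[k] A :=
  TensorProduct.lift <| LinearMap.mk₂ k
    (fun (a : A) (f : ConvDual k C) => f.ofConv.smulRight a)
    (fun a a' f => by ext c; simp) (fun r a f => by ext c; exact smul_comm (f c) r a)
    (fun a f g => by ext c; simp [add_smul]) (fun r a f => by ext c; simp [mul_smul])

theorem toHom_smashMk (D : DoiHopfDatum k H A C) (a : A) (f : ConvDual k C) (c : C) :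
    D.toHom (D.smashMk a f) c = f c • a := by
  rfl

/-! ### Integrals -/

/-- `h ⊗ b ↦ b f(c · h)`. -/
def homLeftAux (D : DoiHopfDatum k H A C) (f : C →ₗ[k] A) (c : C) : H ⊗[k] A →ₗ[k] A :=
  TensorProduct.lift ((LinearMap.mul k A).flip ∘ₗ f ∘ₗ D.act c)

/-- The left action of `A` on `Hom(C, A)`: `(a · f)(c) = ∑ a_<0> f(c · a_<-1>)`. -/
def homLeft (D : DoiHopfDatum k H A C) : A →ₗ[k] (C →ₗ[k] A) →ₗ[k] C →ₗ[k] A :=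
  LinearMap.mk₂ k
    (fun a f =>
      { toFun := fun c => D.homLeftAux f c (D.coact a)
        map_add' := fun c c' => by
          generalize D.coact a = z
          induction z with
          | zero => simp
          | add x z hx hz => rw [map_add, hx, hz, map_add, map_add]; abel
          | tmul h a => simp [homLeftAux]
        map_smul' := fun r c => by
          generalize D.coact a = z
          induction z with
          | zero => simp
          | add x z hx hz => rw [map_add, hx, hz, map_add, smul_add]
          | tmul h a => simp [homLeftAux] })
    (by intros; ext; simp)
    (by intros; ext; simp)
    (fun a f f' => by
      ext c
      simp only [LinearMap.coe_mk, AddHom.coe_mk, LinearMap.add_apply]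
      generalize D.coact a = z
      induction z with
      | zero => simp
      | add x z hx hz => rw [map_add, hx, hz, map_add, map_add]; abel
      | tmul h a => simp [homLeftAux])
    (fun r a f => by
      ext c
      simp only [LinearMap.coe_mk, AddHom.coe_mk, LinearMap.smul_apply]
      generalize D.coact a = z
      induction z with
      | zero => simp
      | add x z hx hz => rw [map_add, hx, hz, map_add, smul_add]
      | tmul h a => simp [homLeftAux])

/-- The right action of `A` on `Hom(C, A)`: `(f · a)(c) = f(c) a`. -/
def homRight (_D : DoiHopfDatum k H A C) (f : C →ₗ[k] A) (a : A) : C →ₗ[k] A :=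
  LinearMap.mulRight k a ∘ₗ f

/-- `∑ a_<0> · γ(c · a_<-1>)`, the value at `c` of the left action of `a` on
`γ : C → Hom(C, A)`. -/
def centralLeft (D : DoiHopfDatum k H A C) (γ : C →ₗ[k] C →ₗ[k] A) (a : A) (c : C) :
    C →ₗ[k] A :=
  TensorProduct.lift (D.homLeft.flip ∘ₗ γ ∘ₗ D.act c) (D.coact a)

/-- `d₁ ⊗ d₂ ↦ ∑ d₂ · f(d₁)_<-1> ⊗ f(d₁)_<0>`. -/
def actCoact (D : DoiHopfDatum k H A C) (f : C →ₗ[k] A) : C ⊗[k] C →ₗ[k] C ⊗[k] A :=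
  TensorProduct.lift (LinearMap.mk₂ k
    (fun d₁ d₂ => LinearMap.rTensor A (D.act d₂) (D.coact (f d₁)))
    (by simp) (by simp) (by simp [LinearMap.rTensor_add]) (by simp [LinearMap.rTensor_smul]))

/-- A `k`-linear map `γ : C → Hom(C, A)` is an `A`-integral for the datum `(H, A, C)` if
* `∑ a_<0> · γ(c · a_<-1>) = γ(c) · a` for all `a`, `c`, and
* `∑ c₍₁₎ ⊗ γ(c₍₂₎)(d) = ∑ d₍₂₎ · γ(c)(d₍₁₎)_<-1> ⊗ γ(c)(d₍₁₎)_<0>` for all `c`, `d`. -/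
structure IsIntegral (D : DoiHopfDatum k H A C) (γ : C →ₗ[k] C →ₗ[k] A) : Prop where
  central : ∀ (a : A) (c : C), D.centralLeft γ a c = D.homRight (γ c) a
  colinear : ∀ c d : C,
    LinearMap.lTensor C (γ.flip d) (Coalgebra.comul (R := k) c) =
      D.actCoact (γ c) (Coalgebra.comul (R := k) d)

/-- An `A`-integral is normalized if `∑ γ(c₍₁₎)(c₍₂₎) = ε(c) 1`. -/
structure IsNormalizedIntegral (D : DoiHopfDatum k H A C) (γ : C →ₗ[k] C →ₗ[k] A) : Prop
    extends D.IsIntegral γ where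
  normalized : ∀ c : C,
    TensorProduct.lift γ (Coalgebra.comul (R := k) c) =
      algebraMap k A (Coalgebra.counit (R := k) c)

end

end DoiHopfDatum

end

/-! Write `S` for `A # C^*`. A bimodule splitting of the multiplication is determined by the image
of `1`, so separability means that `S ⊗_A S` contains a normalized Casimir element: some `e` with `s
e = e s` for all `s`, and with product `1` (`isSeparableExtension_iff_exists_casimir`).

Since `a # f = (1 # f)(a # ε)`, moving the `A`-part across the tensor sign gives `S ⊗_A S ≅ C^* ⊗
S`, which is `Hom(C, S)` because `C` is finitely generated projective (`relHom_bijective`). Thus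
elements `e` are the same as maps `γ : C → S`. As `S` is generated by `A` and `C^*`, the Casimir
condition splits in two: commuting with `A` is the centrality of `γ`, and commuting with every `1 #
f` is the colinearity of `γ` with its `C`-leg paired with `f`. Product `1` is normalization
(`isNormalizedIntegral_relHom_iff`).

The semisimplicity claim is a Maschke argument: an `A`-linear projection `p` onto a left ideal is
averaged to `x ↦ ∑ s p(t x)`, where `e = ∑ s ⊗ t`. -/

section Casimir

open SeparableExtension

variable {k A S : Type*} [CommRing k] [Ring A] [Algebra k A] [Ring S] [Algebra k S]

/-! ### Bimodule calculus in `S ⊗_A S`, Casimir elements and averaging. -/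

namespace SeparableExtension

/-- The class of `s ⊗ t` in `S ⊗_A S`. -/
def relMk (f : A →ₐ[k] S) : S ⊗[k] S →ₗ[k] RelTensor f := (balanced f).mkQ

@[simp]
theorem leftMul_relMk (f : A →ₐ[k] S) (s t u : S) :
    leftMul f s (relMk f (t ⊗ₜ u)) = relMk f ((s * t) ⊗ₜ u) := rfl

@[simp]
theorem rightMul_relMk (f : A →ₐ[k] S) (s t u : S) :
    rightMul f s (relMk f (t ⊗ₜ u)) = relMk f (t ⊗ₜ (u * s)) := rfl

@[simp]
theorem mulMap_relMk (f : A →ₐ[k] S) (t u : S) : mulMap f (relMk f (t ⊗ₜ u)) = t * u := rfl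

theorem relMk_mul_tmul (f : A →ₐ[k] S) (s t : S) (a : A) :
    relMk f ((s * f a) ⊗ₜ t) = relMk f (s ⊗ₜ (f a * t)) := by
  rw [← sub_eq_zero, ← map_sub]
  exact (Submodule.Quotient.mk_eq_zero _).2 (Submodule.subset_span ⟨s, t, a, rfl⟩)

theorem relTensor_induction (f : A →ₐ[k] S) {p : RelTensor f → Prop} (e : RelTensor f)
    (zero : p 0) (add : ∀ x y, p x → p y → p (x + y)) (tmul : ∀ s t, p (relMk f (s ⊗ₜ t))) :
    p e := by
  obtain ⟨x, rfl⟩ := (balanced f).mkQ_surjective e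
  induction x with
  | zero => simpa using zero
  | add x y hx hy => rw [map_add]; exact add _ _ hx hy
  | tmul s t => exact tmul s t

theorem leftMul_mul (f : A →ₐ[k] S) (s t : S) (e : RelTensor f) :
    leftMul f (s * t) e = leftMul f s (leftMul f t e) := by
  induction e using relTensor_induction with
  | zero => simp
  | add x y hx hy => simp only [map_add, hx, hy]
  | tmul u v => simp [mul_assoc]

theorem rightMul_mul (f : A →ₐ[k] S) (s t : S) (e : RelTensor f) :
    rightMul f (s * t) e = rightMul f t (rightMul f s e) := by
  induction e using relTensor_induction with
  | zero => simp
  | add x y hx hy => simp only [map_add, hx, hy]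
  | tmul u v => simp [mul_assoc]

theorem leftMul_rightMul (f : A →ₐ[k] S) (s t : S) (e : RelTensor f) :
    leftMul f s (rightMul f t e) = rightMul f t (leftMul f s e) := by
  induction e using relTensor_induction with
  | zero => simp
  | add x y hx hy => simp only [map_add, hx, hy]
  | tmul u v => simp

theorem leftMul_add (f : A →ₐ[k] S) (s t : S) (e : RelTensor f) :
    leftMul f (s + t) e = leftMul f s e + leftMul f t e := by
  induction e using relTensor_induction with
  | zero => simp
  | add x y hx hy => simp only [map_add, hx, hy]; abel
  | tmul u v => simp [add_mul, TensorProduct.add_tmul]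

theorem rightMul_add (f : A →ₐ[k] S) (s t : S) (e : RelTensor f) :
    rightMul f (s + t) e = rightMul f s e + rightMul f t e := by
  induction e using relTensor_induction with
  | zero => simp
  | add x y hx hy => simp only [map_add, hx, hy]; abel
  | tmul u v => simp [mul_add, TensorProduct.tmul_add]

theorem leftMul_smul (f : A →ₐ[k] S) (r : k) (s : S) (e : RelTensor f) :
    leftMul f (r • s) e = r • leftMul f s e := by
  induction e using relTensor_induction with
  | zero => simp
  | add x y hx hy => simp only [map_add, hx, hy, smul_add]
  | tmul u v =>
    rw [leftMul_relMk, leftMul_relMk, smul_mul_assoc, ← TensorProduct.smul_tmul', map_smul]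

theorem mulMap_leftMul (f : A →ₐ[k] S) (s : S) (e : RelTensor f) :
    mulMap f (leftMul f s e) = s * mulMap f e := by
  induction e using relTensor_induction with
  | zero => simp
  | add x y hx hy => simp only [map_add, hx, hy, mul_add]
  | tmul u v => simp [mul_assoc]

end SeparableExtension

/-- A ring extension is separable iff it has a normalized Casimir element. -/
theorem isSeparableExtension_iff_exists_casimir (f : A →ₐ[k] S) :
    IsSeparableExtension f ↔
      ∃ e : RelTensor f, (∀ s, leftMul f s e = rightMul f s e) ∧ mulMap f e = 1 := by
  constructor
  · rintro ⟨σ, hl, hr, hm⟩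
    exact ⟨σ 1, fun s => by rw [← hl, ← hr, mul_one, one_mul], hm 1⟩
  · rintro ⟨e, he, hm⟩
    -- The splitting is `s ↦ s e`; the Casimir property makes it right linear.
    refine ⟨{ toFun := fun s => leftMul f s e
              map_add' := fun s t => leftMul_add f s t e
              map_smul' := fun r s => leftMul_smul f r s e }, fun s t => ?_, fun s t => ?_,
      fun s => ?_⟩
    · exact leftMul_mul f s t e
    · change leftMul f (s * t) e = rightMul f t (leftMul f s e)
      rw [leftMul_mul, he t, leftMul_rightMul]
    · change mulMap f (leftMul f s e) = s
      rw [mulMap_leftMul, hm, mul_one]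

/-- A separable extension of a semisimple ring is semisimple. -/
theorem IsSeparableExtension.isSemisimpleRing {f : A →ₐ[k] S} (hf : IsSeparableExtension f)
    [IsSemisimpleRing A] : IsSemisimpleRing S := by
  obtain ⟨e, he, hm⟩ := (isSeparableExtension_iff_exists_casimir f).1 hf
  let _ : Module A S := Module.compHom S f.toRingHom
  refine (isSemisimpleModule_iff S S).2 ⟨fun N => ?_⟩
  let N' : Submodule A S :=
    { N.toAddSubmonoid with smul_mem' := fun a x hx => N.smul_mem (f a) hx }
  obtain ⟨q, hq⟩ := exists_isCompl N'
  let p : S →ₗ[A] S := N'.subtype ∘ₗ N'.projectionOnto q hq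
  have hpN (x : S) : p x ∈ N := (N'.projectionOnto q hq x).2
  have hp (x : S) (hx : x ∈ N) : p x = x :=
    congrArg Subtype.val (Submodule.projectionOnto_apply_left hq (⟨x, hx⟩ : N'))
  have hpf (a : A) (x : S) : p (f a * x) = f a * p x := p.map_smul a x
  have hpk (r : k) (x : S) : p (r • x) = r • p x := by
    simpa [Algebra.smul_def] using hpf (algebraMap k A r) x
  let pk : S →ₗ[k] S := { toFun := p, map_add' := p.map_add, map_smul' := hpk }
  -- `P x (s ⊗ t) = s p(t x)` is balanced over `A` because `p` is `A`-linear.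
  let P (x : S) : RelTensor f →ₗ[k] S := (balanced f).liftQ
    (LinearMap.mul' k S ∘ₗ LinearMap.lTensor S (pk ∘ₗ LinearMap.mulRight k x)) (by
      rw [balanced, Submodule.span_le]
      rintro _ ⟨s, t, a, rfl⟩
      simp [pk, mul_assoc, hpf])
  have P_mk (x s t : S) : P x (relMk f (s ⊗ₜ t)) = s * p (t * x) := rfl
  have P_add (x y : S) (u : RelTensor f) : P (x + y) u = P x u + P y u := by
    induction u using relTensor_induction with
    | zero => simp
    | add u v hu hv => simp only [map_add, hu, hv]; abel
    | tmul s t => simp [P_mk, mul_add]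
  have P_right (x y : S) (u : RelTensor f) : P (x * y) u = P y (rightMul f x u) := by
    induction u using relTensor_induction with
    | zero => simp
    | add u v hu hv => simp only [map_add, hu, hv]
    | tmul s t => simp [P_mk, mul_assoc]
  have P_left (x y : S) (u : RelTensor f) : P y (leftMul f x u) = x * P y u := by
    induction u using relTensor_induction with
    | zero => simp
    | add u v hu hv => simp only [map_add, hu, hv, mul_add]
    | tmul s t => simp [P_mk, mul_assoc]
  have P_mem (x : S) (u : RelTensor f) : P x u ∈ N := by
    induction u using relTensor_induction with
    | zero => simp
    | add u v hu hv => rw [map_add]; exact N.add_mem hu hv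
    | tmul s t => exact N.smul_mem s (hpN _)
  have P_fix (x : S) (hx : x ∈ N) (u : RelTensor f) : P x u = mulMap f u * x := by
    induction u using relTensor_induction with
    | zero => simp
    | add u v hu hv => simp only [map_add, hu, hv, add_mul]
    | tmul s t => rw [P_mk, hp (t * x) (N.smul_mem t hx), mulMap_relMk, mul_assoc]
  -- Averaged projection: `S`-linear because `e` is Casimir, and the identity on `N` because `e` has
  -- product `1`.
  let π : S →ₗ[S] N :=
    { toFun := fun x => ⟨P x e, P_mem x e⟩
      map_add' := fun x y => Subtype.ext (P_add x y e)
      map_smul' := fun s x => Subtype.ext (by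
        change P (s * x) e = s * P x e
        rw [P_right, ← he, P_left]) }
  exact ⟨_, LinearMap.isCompl_of_proj (f := π) fun x => Subtype.ext (by
    change P x e = x
    rw [P_fix _ x.2, hm, one_mul])⟩

end Casimir

/-- A finitely generated projective module has a dual basis, so the identity of `C` is a finite sum
of maps `f(-) c`, and an element of `C ⊗ A` is recovered from its pairings with functionals. -/
theorem rTensor_dual_injective {k C A : Type*} [CommRing k] [AddCommGroup C] [Module k C]
    [AddCommGroup A] [Module k A] [Module.Finite k C] [Module.Projective k C] {x y : C ⊗[k] A}
    (h : ∀ f : C →ₗ[k] k, LinearMap.rTensor A f x = LinearMap.rTensor A f y) : x = y := by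
  obtain ⟨t, ht⟩ := (dualTensorHom_bijective (R := k) (M := C) (N := C)).2 LinearMap.id
  suffices H : ∀ t : Module.Dual k C ⊗[k] C, LinearMap.rTensor A (dualTensorHom k C C t) x =
      LinearMap.rTensor A (dualTensorHom k C C t) y by simpa [ht] using H t
  intro t
  induction t with
  | zero => simp
  | add t u ht hu => simp only [map_add, LinearMap.rTensor_add, LinearMap.add_apply, ht, hu]
  | tmul f c =>
    have : dualTensorHom k C C (f ⊗ₜ c) = LinearMap.toSpanSingleton k C c ∘ₗ f := by ext; simp
    simp [this, LinearMap.rTensor_comp_apply, h f]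

/-! ### Multiplication of the smash product, read in `Hom(C, A)`. -/

namespace DoiHopfDatum

open SeparableExtension

variable {k H A C : Type*} [CommRing k] [Ring H] [Bialgebra k H]
  [Ring A] [Algebra k A] [AddCommGroup C] [Module k C] [Coalgebra k C]

theorem smashMk_induction (D : DoiHopfDatum k H A C) {p : D.Smash → Prop} (x : D.Smash)
    (zero : p 0) (add : ∀ x y, p x → p y → p (x + y)) (mk : ∀ a f, p (D.smashMk a f)) : p x :=
  TensorProduct.induction_on (motive := p) x zero mk add

theorem smashMk_eq (D : DoiHopfDatum k H A C) (a : A) (f : ConvDual k C) :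
    D.smashMk a f = D.smashMk 1 f * D.incl a := by
  change a ⊗ₜ[k] f = D.smashMul (1 ⊗ₜ f) (a ⊗ₜ 1)
  simp

theorem smash_induction (D : DoiHopfDatum k H A C) {p : D.Smash → Prop} (x : D.Smash)
    (zero : p 0) (add : ∀ x y, p x → p y → p (x + y))
    (mk : ∀ f a, p (D.smashMk 1 f * D.incl a)) : p x := by
  induction x using D.smashMk_induction with
  | zero => exact zero
  | add x y hx hy => exact add x y hx hy
  | mk a f => rw [smashMk_eq]; exact mk f a

theorem toHom_mk_mul_incl (D : DoiHopfDatum k H A C) (f : ConvDual k C) (a : A) (c : C) :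
    D.toHom (D.smashMk 1 f * D.incl a) c = f c • a := by
  rw [← smashMk_eq, toHom_smashMk]

theorem toHom_one (D : DoiHopfDatum k H A C) (c : C) :
    D.toHom 1 c = algebraMap k A (Coalgebra.counit (R := k) c) := by
  rw [Algebra.algebraMap_eq_smul_one]
  exact D.toHom_smashMk 1 1 c

theorem toHom_mul_incl (D : DoiHopfDatum k H A C) (s : D.Smash) (a : A) (c : C) :
    D.toHom (s * D.incl a) c = D.toHom s c * a := by
  induction s using D.smash_induction with
  | zero => simp
  | add x y hx hy => simp only [add_mul, map_add, LinearMap.add_apply, hx, hy]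
  | mk f b => rw [mul_assoc, ← map_mul, toHom_mk_mul_incl, toHom_mk_mul_incl, smul_mul_assoc]

theorem toHom_incl_mul (D : DoiHopfDatum k H A C) (s : D.Smash) (a : A) :
    D.toHom (D.incl a * s) = D.homLeft a (D.toHom s) := by
  induction s using D.smashMk_induction with
  | zero => simp
  | add x y hx hy => simp only [mul_add, map_add, hx, hy]
  | mk b g =>
    ext c
    -- An arbitrary `z` in place of `D.coact a` makes the identity linear, so pure tensors suffice;
    -- `T` is `D.toHom` with domain read as `A ⊗ C^*`.
    have key (T : A ⊗[k] ConvDual k C →ₗ[k] C →ₗ[k] A) (hT : ∀ a f c, T (a ⊗ₜ f) c = f c • a)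
        (z : H ⊗[k] A) : T (convOp A 1 (D.twist z (b ⊗ₜ g))) c =
          D.homLeftAux (T (b ⊗ₜ g)) c z := by
      induction z with
      | zero => simp
      | add x z hx hz => simp only [map_add, LinearMap.add_apply, hx, hz]
      | tmul h a => simp [homLeftAux, hT]
    refine Eq.trans ?_ (key D.toHom (fun _ _ _ => rfl) (D.coact a))
    change D.toHom (D.smashMul (a ⊗ₜ 1) (b ⊗ₜ g)) c = _
    rw [smashMul_tmul]
    rfl

/-- Left multiplication by `1 # f` only convolves the `C^*`-factor, and `f * g` is `g` precomposed
with `c ↦ ∑ ⟨f, c₍₁₎⟩ c₍₂₎`. -/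
theorem toHom_mk_mul (D : DoiHopfDatum k H A C) (f : ConvDual k C) (s : D.Smash) (c : C) :
    D.toHom (D.smashMk 1 f * s) c = D.toHom s
      (TensorProduct.lid k C (LinearMap.rTensor C f.ofConv (Coalgebra.comul (R := k) c))) := by
  induction s using D.smash_induction with
  | zero => simp
  | add x y hx hy => simp only [mul_add, map_add, LinearMap.add_apply, hx, hy]
  | mk g b =>
    have : D.smashMk 1 f * D.smashMk 1 g = D.smashMk 1 (f * g) := by
      change D.smashMul (1 ⊗ₜ f) (1 ⊗ₜ g) = 1 ⊗ₜ[k] (f * g)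
      simp
    rw [← mul_assoc, this, toHom_mk_mul_incl, toHom_mk_mul_incl]
    have hl : (f * g) c = LinearMap.mul' k k (TensorProduct.map f.ofConv g.ofConv
      (Coalgebra.comul (R := k) c)) := rfl
    rw [hl]
    congr 1
    generalize Coalgebra.comul (R := k) c = z
    induction z with
    | zero => simp
    | add x z hx hz => simp only [map_add, hx, hz]
    | tmul h a => simp

/-- In `(1 # g)(b # ε)(1 # f)` the factor `g` consumes `c₍₁₎`, while `b` acting on `1 # f` yields `∑
⟨f, c₍₂₎ · b_<-1>⟩ b_<0>`. This is how the right side of colinearity arises, paired with `f`. -/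
theorem toHom_mul_mk (D : DoiHopfDatum k H A C) (f : ConvDual k C) (s : D.Smash) (c : C) :
    D.toHom (s * D.smashMk 1 f) c = TensorProduct.lid k A (LinearMap.rTensor A f.ofConv
      (D.actCoact (D.toHom s) (Coalgebra.comul (R := k) c))) := by
  induction s using D.smash_induction with
  | zero =>
    have : D.actCoact (0 : C →ₗ[k] A) = 0 := by ext; simp [actCoact]
    simp [this]
  | add x y hx hy =>
    have : D.actCoact (D.toHom (x + y)) = D.actCoact (D.toHom x) + D.actCoact (D.toHom y) := by
      ext; simp [actCoact]
    rw [add_mul, map_add, LinearMap.add_apply, hx, hy, this, LinearMap.add_apply, map_add, map_add]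
  | mk g b =>
    rw [mul_assoc, toHom_mk_mul, toHom_incl_mul]
    generalize Coalgebra.comul (R := k) c = z
    induction z with
    | zero => simp
    | add x z hx hz => simp only [map_add, hx, hz]
    | tmul d e =>
      have h1 : D.actCoact (D.toHom (D.smashMk 1 g * D.incl b)) (d ⊗ₜ e) =
          g d • LinearMap.rTensor A (D.act e) (D.coact b) := by
        simp [actCoact, toHom_mk_mul_incl]
      have h2 : D.homLeft b (D.toHom (D.smashMk 1 f)) e =
          D.homLeftAux (D.toHom (D.smashMk 1 f)) e (D.coact b) := rfl
      rw [h1]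
      simp only [LinearMap.rTensor_tmul, TensorProduct.lid_tmul, map_smul]
      congr 1
      rw [h2]
      generalize D.coact b = z
      induction z with
      | zero => simp
      | add x z hx hz => simp only [map_add, hx, hz]
      | tmul h a => simp [homLeftAux, toHom_smashMk]

/-! ### The tensor square `S ⊗_A S` as `Hom(C, S)`. -/

theorem lift_zero {M N P : Type*} [AddCommGroup M] [AddCommGroup N] [AddCommGroup P] [Module k M]
    [Module k N] [Module k P] : TensorProduct.lift (0 : M →ₗ[k] N →ₗ[k] P) = 0 :=
  TensorProduct.ext' fun _ _ => rfl

theorem lift_add {M N P : Type*} [AddCommGroup M] [AddCommGroup N] [AddCommGroup P] [Module k M]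
    [Module k N] [Module k P] (f g : M →ₗ[k] N →ₗ[k] P) :
    TensorProduct.lift (f + g) = TensorProduct.lift f + TensorProduct.lift g :=
  TensorProduct.ext' fun _ _ => rfl

/-- The map `(A # C^*) ⊗_A (A # C^*) → Hom(C, A # C^*)`, `(a # f) ⊗ t ↦ (c ↦ ⟨f, c⟩ a t)`. -/
noncomputable def relHom (D : DoiHopfDatum k H A C) : RelTensor D.incl →ₗ[k] C →ₗ[k] D.Smash :=
  (balanced D.incl).liftQ
    (TensorProduct.lift (LinearMap.mk₂ k
      (fun s t => LinearMap.mulRight k t ∘ₗ D.incl.toLinearMap ∘ₗ D.toHom s)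
      (fun s s' t => by ext; simp [add_mul]) (fun r s t => by ext; simp)
      (fun s t t' => by ext; simp [mul_add]) (fun r s t => by ext; simp))) (by
    rw [balanced, Submodule.span_le]
    rintro _ ⟨s, t, a, rfl⟩
    refine LinearMap.mem_ker.2 (LinearMap.ext fun c => ?_)
    simp [toHom_mul_incl, mul_assoc])

@[simp]
theorem relHom_relMk (D : DoiHopfDatum k H A C) (s t : D.Smash) (c : C) :
    D.relHom (relMk D.incl (s ⊗ₜ t)) c = D.incl (D.toHom s c) * t := rfl

/-- The map `ψ : C^* ⊗ S → S ⊗_A S` is onto, since the `A`-part of the left factor can cross the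
tensor sign. Its composite with `D.relHom` is the canonical map `C^* ⊗ S → Hom(C, S)`, bijective for
finitely generated projective `C`; hence `D.relHom` is bijective too. -/
theorem relHom_bijective [Module.Finite k C] [Module.Projective k C]
    (D : DoiHopfDatum k H A C) : Function.Bijective D.relHom := by
  let ψ : Module.Dual k C ⊗[k] D.Smash →ₗ[k] RelTensor D.incl :=
    relMk D.incl ∘ₗ LinearMap.rTensor D.Smash
      (TensorProduct.mk k A (ConvDual k C) 1 ∘ₗ (WithConv.linearEquiv k _).symm.toLinearMap)
  have hψ (f : ConvDual k C) (t : D.Smash) :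
    ψ (f.ofConv ⊗ₜ t) = relMk D.incl (D.smashMk 1 f ⊗ₜ t) := rfl
  have hψs : Function.Surjective ψ := by
    rw [← LinearMap.range_eq_top, eq_top_iff]
    intro e he
    clear he
    induction e using relTensor_induction with
    | zero => simp
    | add x y hx hy => exact add_mem hx hy
    | tmul s t =>
      induction s using D.smash_induction with
      | zero => simp
      | add x y hx hy => rw [TensorProduct.add_tmul, map_add]; exact add_mem hx hy
      | mk f a => rw [relMk_mul_tmul]; exact ⟨_, hψ f _⟩
  have hd : D.relHom ∘ₗ ψ = dualTensorHom k C D.Smash := by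
    refine TensorProduct.ext' fun f t => LinearMap.ext fun c => ?_
    change D.relHom (ψ ((WithConv.toConv f).ofConv ⊗ₜ t)) c = _
    rw [hψ, relHom_relMk, toHom_smashMk]
    simp
  have hb : Function.Bijective (D.relHom ∘ ψ) := by
    rw [← LinearMap.coe_comp, hd]
    exact dualTensorHom_bijective
  exact ⟨(Function.Injective.of_comp_right hb.1 hψs), hb.2.of_comp⟩

theorem toHom_injective [Module.Finite k C] [Module.Projective k C]
    (D : DoiHopfDatum k H A C) : Function.Injective D.toHom := by
  let ψ : Module.Dual k C ⊗[k] A ≃ₗ[k] D.Smash :=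
    (TensorProduct.comm k _ _).trans
      (TensorProduct.congr (LinearEquiv.refl k A) (WithConv.linearEquiv k _).symm)
  have hd : D.toHom ∘ₗ ψ.toLinearMap = dualTensorHom k C A :=
    TensorProduct.ext' fun f a => rfl
  have hb : Function.Injective (D.toHom ∘ ψ) := by
    have := (dualTensorHom_bijective (R := k) (M := C) (N := A)).1
    rwa [← hd, LinearMap.coe_comp] at this
  exact Function.Injective.of_comp_right hb ψ.surjective

/-! ### From Casimir conditions to integral conditions. -/

theorem relHom_rightMul (D : DoiHopfDatum k H A C) (s : D.Smash) (e : RelTensor D.incl) (c : C) :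
    D.relHom (rightMul D.incl s e) c = D.relHom e c * s := by
  induction e using relTensor_induction with
  | zero => simp
  | add x y hx hy => simp only [map_add, LinearMap.add_apply, hx, hy, add_mul]
  | tmul u v => simp [mul_assoc]

theorem relHom_leftMul_mk (D : DoiHopfDatum k H A C) (f : ConvDual k C) (e : RelTensor D.incl)
    (c : C) : D.relHom (leftMul D.incl (D.smashMk 1 f) e) c = D.relHom e
      (TensorProduct.lid k C (LinearMap.rTensor C f.ofConv (Coalgebra.comul (R := k) c))) := by
  induction e using relTensor_induction with
  | zero => simp
  | add x y hx hy => simp only [map_add, LinearMap.add_apply, hx, hy]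
  | tmul u v => simp [toHom_mk_mul]

/-- Both sides come from `∑ a_<0> γ(c · a_<-1>)` computed in `S`, as `D.toHom` turns left
multiplication by `A` into `D.homLeft`. -/
theorem toHom_relHom_leftMul_incl (D : DoiHopfDatum k H A C) (a : A) (e : RelTensor D.incl)
    (c : C) : D.toHom (D.relHom (leftMul D.incl (D.incl a) e) c) =
      D.centralLeft (D.toHom ∘ₗ D.relHom e) a c := by
  induction e using relTensor_induction with
  | zero => simp [centralLeft, lift_zero]
  | add x y hx hy =>
    simp only [map_add, LinearMap.add_apply, hx, hy, centralLeft, LinearMap.comp_add,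
      LinearMap.add_comp, lift_add]
  | tmul u v =>
    rw [leftMul_relMk, relHom_relMk, toHom_incl_mul D u]
    change D.toHom (D.incl (D.homLeftAux (D.toHom u) c (D.coact a)) * v) = _
    rw [centralLeft]
    generalize D.coact a = z
    induction z with
    | zero => simp
    | add x z hx hz => simp only [map_add, add_mul, hx, hz]
    | tmul h b => simp [homLeftAux, mul_assoc, ← toHom_incl_mul]

/-- For `e = (1 # f)(a # ε) ⊗ v`, the functional `f` consumes `c₍₁₎` and leaves `a v` evaluated at
`c₍₂₎`. -/
theorem toHom_mulMap (D : DoiHopfDatum k H A C) (e : RelTensor D.incl) (c : C) :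
    D.toHom (mulMap D.incl e) c =
      TensorProduct.lift (D.toHom ∘ₗ D.relHom e) (Coalgebra.comul (R := k) c) := by
  induction e using relTensor_induction with
  | zero => simp [lift_zero]
  | add x y hx hy =>
    simp only [map_add, LinearMap.add_apply, hx, hy, LinearMap.comp_add, lift_add]
  | tmul u v =>
    rw [mulMap_relMk]
    induction u using D.smash_induction with
    | zero => simp [lift_zero]
    | add x y hx hy =>
      simp only [add_mul, TensorProduct.add_tmul, map_add, LinearMap.add_apply, hx, hy,
        LinearMap.comp_add, lift_add]
    | mk f a =>
      rw [mul_assoc, toHom_mk_mul]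
      generalize Coalgebra.comul (R := k) c = z
      induction z with
      | zero => simp
      | add x z hx hz => simp only [map_add, hx, hz]
      | tmul d e => simp [toHom_mk_mul_incl]

/-- `e` is a normalized Casimir element iff the corresponding map is a normalized integral. -/
theorem isNormalizedIntegral_relHom_iff [Module.Finite k C] [Module.Projective k C]
    (D : DoiHopfDatum k H A C) (e : RelTensor D.incl) :
    D.IsNormalizedIntegral (D.toHom ∘ₗ D.relHom e) ↔
      (∀ s, leftMul D.incl s e = rightMul D.incl s e) ∧ mulMap D.incl e = 1 := by
  have hcentral (a : A) : leftMul D.incl (D.incl a) e = rightMul D.incl (D.incl a) e ↔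
      ∀ c, D.centralLeft (D.toHom ∘ₗ D.relHom e) a c =
        D.homRight ((D.toHom ∘ₗ D.relHom e) c) a := by
    rw [← D.relHom_bijective.1.eq_iff, LinearMap.ext_iff]
    refine forall_congr' fun c => ?_
    rw [← D.toHom_injective.eq_iff, toHom_relHom_leftMul_incl, relHom_rightMul]
    have : D.toHom (D.relHom e c * D.incl a) = D.homRight (D.toHom (D.relHom e c)) a :=
      LinearMap.ext fun d => D.toHom_mul_incl _ _ _
    rw [this]
    rfl
  have hcolin : (∀ f, leftMul D.incl (D.smashMk 1 f) e = rightMul D.incl (D.smashMk 1 f) e) ↔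
      ∀ c d, LinearMap.lTensor C ((D.toHom ∘ₗ D.relHom e).flip d)
          (Coalgebra.comul (R := k) c) =
        D.actCoact ((D.toHom ∘ₗ D.relHom e) c) (Coalgebra.comul (R := k) d) := by
    -- Commuting with `1 # f` is colinearity after applying `f` to the `C`-leg.
    have key (f : ConvDual k C) (c d : C) :
        D.toHom (D.relHom (leftMul D.incl (D.smashMk 1 f) e) c) d =
        TensorProduct.lid k A (LinearMap.rTensor A f.ofConv (LinearMap.lTensor C
          ((D.toHom ∘ₗ D.relHom e).flip d) (Coalgebra.comul (R := k) c))) := by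
      rw [relHom_leftMul_mk]
      generalize Coalgebra.comul (R := k) c = z
      induction z with
      | zero => simp
      | add x z hx hz => simp only [map_add, LinearMap.add_apply, hx, hz]
      | tmul c c' => simp
    have key' (f : ConvDual k C) :
        leftMul D.incl (D.smashMk 1 f) e = rightMul D.incl (D.smashMk 1 f) e ↔
        ∀ c d, LinearMap.rTensor A f.ofConv (LinearMap.lTensor C
          ((D.toHom ∘ₗ D.relHom e).flip d) (Coalgebra.comul (R := k) c)) =
        LinearMap.rTensor A f.ofConv
          (D.actCoact ((D.toHom ∘ₗ D.relHom e) c) (Coalgebra.comul (R := k) d)) := by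
      rw [← D.relHom_bijective.1.eq_iff, LinearMap.ext_iff]
      refine forall_congr' fun c => ?_
      rw [← D.toHom_injective.eq_iff, LinearMap.ext_iff]
      refine forall_congr' fun d => ?_
      rw [key, relHom_rightMul, toHom_mul_mk, EmbeddingLike.apply_eq_iff_eq]
      rfl
    simp only [key']
    -- Functionals separate the points of `C ⊗ A`, so all these pairings together give colinearity
    -- itself.
    exact ⟨fun h c d => rTensor_dual_injective fun f => h (WithConv.toConv f) c d,
      fun h f c d => by rw [h]⟩
  have hnorm : mulMap D.incl e = 1 ↔ ∀ c, TensorProduct.lift (D.toHom ∘ₗ D.relHom e)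
      (Coalgebra.comul (R := k) c) = algebraMap k A (Coalgebra.counit (R := k) c) := by
    rw [← D.toHom_injective.eq_iff, LinearMap.ext_iff]
    simp only [toHom_mulMap, toHom_one]
  constructor
  · intro h
    refine ⟨fun s => ?_, hnorm.2 h.normalized⟩
    have hA (a : A) := (hcentral a).2 (h.central a)
    have hC := hcolin.2 h.colinear
    induction s using D.smash_induction with
    | zero => simpa using hA 0
    | add x y hx hy => rw [leftMul_add, rightMul_add, hx, hy]
    -- Elements commuting with `e` are closed under products, so the generators `1 # f` and `a # ε`
    -- suffice.
    | mk f a => rw [leftMul_mul, hA, leftMul_rightMul, hC, ← rightMul_mul]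
  · rintro ⟨h, h1⟩
    exact ⟨⟨fun a => (hcentral a).1 (h _), hcolin.1 fun f => h _⟩, hnorm.1 h1⟩

end DoiHopfDatum

theorem corollary3p4p1 {k H A C : Type*} [CommRing k] [Ring H] [HopfAlgebra k H]
    [Ring A] [Algebra k A] [AddCommGroup C] [Module k C] [Coalgebra k C]
    [Module.Finite k C] [Module.Projective k C] (D : DoiHopfDatum k H A C) :
    (IsSeparableExtension D.incl ↔
      ∃ γ : C →ₗ[k] D.Smash, D.IsNormalizedIntegral (D.toHom ∘ₗ γ)) ∧
    (IsSeparableExtension D.incl → IsSemisimpleRing A → IsSemisimpleRing D.Smash) := by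
  refine ⟨?_, fun h _ => h.isSemisimpleRing⟩
  -- Surjectivity of `D.relHom` lets `γ` range over the maps `D.relHom e`.
  simp only [isSeparableExtension_iff_exists_casimir, D.relHom_bijective.2.exists,
    D.isNormalizedIntegral_relHom_iff]
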